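/- Lemma 4.5. Let $\rho\in[-1,1]$ and let $(B_1(t),B_2(t))_{t\ge 0}$ be a standard bidimensional Brownian motion with constant correlation coefficient $\rho$ on a probability space, i.e. $B_1$ and $B_2$ are standard real Brownian motions (started at $0$, with almost surely continuous paths), the pair is jointly Gaussian, and $\mathrm{Cov}(B_1(s),B_2(t))=\rho\min\{s,t\}$ for all $s,t\ge 0$. For $t\ge 0$ and $i=1,2$ put $\overline{B}_i(t)=\sup_{0\le s\le t}B_i(s)$ and $\underline{B}_i(t)=\inf_{0\le s\le t}B_i(s)$. Let $t\ge 0$, $x_1>0$ and $x_2>0$. If $\rho\in[0,1]$, then $$P(\overline{B}_1(t)>x_1,\ \overline{B}_2(t)>x_2)\ \ge\ P(\overline{B}_1(t)>x_1)\,P(\overline{B}_2(t)>x_2)$$ and $$P(\underline{B}_1(t)<-x_1,\ \underline{B}_2(t)<-x_2)\ \ge\ P(\underline{B}_1(t)<-x_1)\,P(\underline{B}_2(t)<-x_2).$$ If $\rho\in[-1,0]$, then $$P(\overline{B}_1(t)>x_1,\ \overline{B}_2(t)>x_2)\ \le\ P(\overline{B}_1(t)>x_1)\,P(\overline{B}_2(t)>x_2)$$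 and $$P(\underline{B}_1(t)<-x_1,\ \underline{B}_2(t)<-x_2)\ \le\ P(\underline{B}_1(t)<-x_1)\,P(\underline{B}_2(t)<-x_2).$$ -/

import Mathlib

open MeasureTheory ProbabilityTheory
open scoped NNReal

/-- `(B₁, B₂)` is a standard bidimensional Brownian motion with constant correlation coefficient
`ρ` under `P`: each coordinate is a standard real Brownian motion (started at `0`, with almost
surely continuous paths), the pair is a jointly Gaussian process with values in the plane, and
`Cov (B₁ s, B₂ t) = ρ * min s t`. -/
structure IsCorrelatedBrownianPair {Ω : Type*} {mΩ : MeasurableSpace Ω}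
    (B₁ B₂ : ℝ≥0 → Ω → ℝ) (ρ : ℝ) (P : Measure Ω) : Prop where
  brownian_fst : IsBrownianReal B₁ P
  brownian_snd : IsBrownianReal B₂ P
  gaussian : IsGaussianProcess (fun t ω ↦ (B₁ t ω, B₂ t ω)) P
  covariance_cross : ∀ s t : ℝ≥0, cov[B₁ s, B₂ t; P] = ρ * min (s : ℝ) (t : ℝ)

/-- The running supremum `sup_{0 ≤ s ≤ t} X s`. -/
noncomputable def runningSup {Ω : Type*} (X : ℝ≥0 → Ω → ℝ) (t : ℝ≥0) (ω : Ω) : ℝ :=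
  ⨆ s : Set.Icc (0 : ℝ≥0) t, X s ω

/-- The running infimum `inf_{0 ≤ s ≤ t} X s`. -/
noncomputable def runningInf {Ω : Type*} (X : ℝ≥0 → Ω → ℝ) (t : ℝ≥0) (ω : Ω) : ℝ :=
  ⨅ s : Set.Icc (0 : ℝ≥0) t, X s ω

/-!
# Positive and negative quadrant dependence of the running extrema of correlated Brownian motions

Put `W = B₂ - ρ B₁`. The processes `B₁` and `W` are jointly Gaussian and uncorrelated, hence
independent. On a finite grid of times starting at `0`, the values of `B₁` are the partial sums of
its increments `X`, which are independent, and the values of `B₂ = ρ B₁ + W` are `ρ` times these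
partial sums plus the values of `W`. So "`B₁` exceeds `x₁` somewhere on the grid" is an increasing
event in `X`, while for each frozen `W` the event "`B₂` exceeds `x₂` somewhere on the grid" is
increasing in `X` if `0 ≤ ρ` and decreasing if `ρ ≤ 0`.

The law of `X` is a product of probability measures on the line, so it is positively associated
(`positivelyAssociated_pi`, the Harris inequality): a linear order gives Chebyshev's inequality
(`positivelyAssociated_of_linearOrder`) and association passes to products
(`PositivelyAssociated.prod`). Applying it for each fixed `W` and integrating over the independent
`W` yields the inequalities on the grid (`IsCorrelatedBrownianPair.measure_exists_gt_finset`).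
Since paths are almost surely continuous, the events for the running suprema are increasing unions
of the events on grids exhausting a countable dense set of times, and the inequalities pass to the
limit. The infima are handled by the reflection `B ↦ -B`.
-/

open scoped ENNReal

/-! ### Positively associated measures -/

/-- A measure on a preordered space is positively associated if any two increasing functions are
nonnegatively correlated under it. The functions take values in `ℝ≥0∞`, so that no integrability
condition is needed. -/
def PositivelyAssociated {E : Type*} [Preorder E] [MeasurableSpace E] (μ : Measure E) : Prop :=
  ∀ f g : E → ℝ≥0∞, Monotone f → Monotone g → Measurable f → Measurable g →
    (∫⁻ x, f x ∂μ) * ∫⁻ x, g x ∂μ ≤ ∫⁻ x, f x * g x ∂μ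

/-- Chebyshev's integral inequality, by integrating the rearrangement inequality
`f x * g y + f y * g x ≤ f x * g x + f y * g y` over two independent copies. -/
lemma positivelyAssociated_of_linearOrder {E : Type*} [LinearOrder E] [MeasurableSpace E]
    (μ : Measure E) [IsProbabilityMeasure μ] : PositivelyAssociated μ := by
  intro f g hf hg mf mg
  have key_of_le : ∀ x y, x ≤ y → f x * g y + f y * g x ≤ f x * g x + f y * g y := by
    intro x y h
    obtain ⟨c, hc⟩ := exists_add_of_le (hf h)
    obtain ⟨d, hd⟩ := exists_add_of_le (hg h)
    calc f x * g y + f y * g x ≤ f x * g y + f y * g x + c * d := le_self_add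
      _ = f x * g x + f y * g y := by rw [hc, hd]; ring
  have key : ∀ x y, f x * g y + f y * g x ≤ f x * g x + f y * g y := by
    intro x y
    rcases le_total x y with h | h
    · exact key_of_le x y h
    · exact (add_comm _ _).trans_le ((key_of_le y x h).trans_eq (add_comm _ _))
  have h1 : ∫⁻ x, ∫⁻ y, (f x * g y + f y * g x) ∂μ ∂μ
      = 2 * ((∫⁻ x, f x ∂μ) * ∫⁻ x, g x ∂μ) := by
    have : ∀ x, ∫⁻ y, (f x * g y + f y * g x) ∂μ
        = f x * (∫⁻ y, g y ∂μ) + (∫⁻ y, f y ∂μ) * g x := by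
      intro x
      rw [lintegral_add_left (by fun_prop), lintegral_const_mul _ mg, lintegral_mul_const _ mf]
    simp_rw [this]
    rw [lintegral_add_left (by fun_prop), lintegral_mul_const _ mf, lintegral_const_mul _ mg,
      two_mul]
  have h2 : ∫⁻ x, ∫⁻ y, (f x * g x + f y * g y) ∂μ ∂μ = 2 * ∫⁻ x, f x * g x ∂μ := by
    have : ∀ x, ∫⁻ y, (f x * g x + f y * g y) ∂μ = f x * g x + ∫⁻ y, f y * g y ∂μ := by
      intro x
      rw [lintegral_add_left (by fun_prop)]
      simp
    simp_rw [this]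
    rw [lintegral_add_left (by fun_prop)]
    simp [two_mul]
  have h3 := lintegral_mono (μ := μ) fun x ↦ lintegral_mono (μ := μ) (key x)
  rw [h1, h2] at h3
  exact (ENNReal.mul_le_mul_iff_right (by simp) (by simp)).1 h3

lemma PositivelyAssociated.prod {E F : Type*} [Preorder E] [MeasurableSpace E] [Preorder F]
    [MeasurableSpace F] {μ : Measure E} {ν : Measure F} [SFinite ν]
    (hμ : PositivelyAssociated μ) (hν : PositivelyAssociated ν) :
    PositivelyAssociated (μ.prod ν) := by
  intro f g hf hg mf mg
  rw [lintegral_prod _ mf.aemeasurable, lintegral_prod _ mg.aemeasurable,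
    lintegral_prod (fun p ↦ f p * g p) (by fun_prop)]
  refine (hμ _ _ ?_ ?_ mf.lintegral_prod_right' mg.lintegral_prod_right').trans ?_
  · exact fun x x' h ↦ lintegral_mono fun y ↦ hf ⟨h, le_rfl⟩
  · exact fun x x' h ↦ lintegral_mono fun y ↦ hg ⟨h, le_rfl⟩
  · refine lintegral_mono fun x ↦ hν _ _ ?_ ?_ (by fun_prop) (by fun_prop)
    · exact fun y y' h ↦ hf ⟨le_rfl, h⟩
    · exact fun y y' h ↦ hg ⟨le_rfl, h⟩

lemma PositivelyAssociated.map {E F : Type*} [Preorder E] [MeasurableSpace E] [Preorder F]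
    [MeasurableSpace F] {μ : Measure E} {φ : E → F}
    (hμ : PositivelyAssociated μ) (hφ : Monotone φ) (mφ : Measurable φ) :
    PositivelyAssociated (μ.map φ) := by
  intro f g hf hg mf mg
  rw [lintegral_map mf mφ, lintegral_map mg mφ, lintegral_map (f := fun y ↦ f y * g y) (by fun_prop) mφ]
  exact hμ _ _ (hf.comp hφ) (hg.comp hφ) (mf.comp mφ) (mg.comp mφ)

/-- The **Harris inequality**: a finite product of probability measures on linear orders is
positively associated for the coordinatewise order. -/
lemma positivelyAssociated_pi {E : Type*} [LinearOrder E] [MeasurableSpace E] :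
    ∀ {n : ℕ} (μ : Fin n → Measure E) [∀ i, IsProbabilityMeasure (μ i)],
      PositivelyAssociated (Measure.pi μ)
  | 0, μ, _ => by
    intro f g _ _ _ _
    have : ∀ h : (Fin 0 → E) → ℝ≥0∞, ∫⁻ x, h x ∂Measure.pi μ = h default := by
      intro h
      rw [lintegral_unique]
      simp
    rw [this, this, this]
  | n + 1, μ, _ => by
    rw [← (measurePreserving_piFinSuccAbove μ 0).symm.map_eq]
    refine ((positivelyAssociated_of_linearOrder (μ 0)).prod
      (positivelyAssociated_pi fun j ↦ μ (Fin.succAbove 0 j))).map ?_ (MeasurableEquiv.measurable _)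
    intro x y h i
    refine Fin.cases ?_ (fun j ↦ ?_) i
    · simpa using h.1
    · simpa using h.2 j

lemma PositivelyAssociated.measure_mul_le {E : Type*} [Preorder E] [MeasurableSpace E]
    {μ : Measure E} (hμ : PositivelyAssociated μ) {A B : Set E} (hA : IsUpperSet A)
    (hB : IsUpperSet B) (mA : MeasurableSet A) (mB : MeasurableSet B) :
    μ A * μ B ≤ μ (A ∩ B) := by
  have mono : ∀ {S : Set E}, IsUpperSet S → Monotone (S.indicator (1 : E → ℝ≥0∞)) := by
    intro S hS x y h
    by_cases hx : x ∈ S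
    · simp [hx, hS h hx]
    · simp [hx]
  have := hμ _ _ (mono hA) (mono hB) (measurable_one.indicator mA) (measurable_one.indicator mB)
  have hAB : ∀ x, A.indicator (1 : E → ℝ≥0∞) x * B.indicator 1 x = (A ∩ B).indicator 1 x := by
    intro x
    rw [Set.inter_indicator_one]
    rfl
  simp_rw [hAB] at this
  rwa [lintegral_indicator_one mA, lintegral_indicator_one mB,
    lintegral_indicator_one (mA.inter mB)] at this

/-- Association in the first coordinate, conditionally on an independent second coordinate that
does not affect the first event. -/
lemma PositivelyAssociated.measure_mul_prod_le {E F : Type*} [Preorder E] [MeasurableSpace E]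
    [MeasurableSpace F] {μ : Measure E} {ν : Measure F} [SFinite μ] [SFinite ν]
    (hμ : PositivelyAssociated μ) {A : Set E} {C : Set (E × F)} (hA : IsUpperSet A)
    (hC : ∀ w, IsUpperSet {x | (x, w) ∈ C}) (mA : MeasurableSet A) (mC : MeasurableSet C) :
    μ A * μ.prod ν C ≤ μ.prod ν (Prod.fst ⁻¹' A ∩ C) := by
  rw [Measure.prod_apply_symm mC, Measure.prod_apply_symm ((measurable_fst mA).inter mC),
    ← lintegral_const_mul _ (measurable_measure_prodMk_right mC)]
  exact lintegral_mono fun w ↦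
    hμ.measure_mul_le hA (hC w) mA (measurable_prodMk_right mC)

/-- The version of `PositivelyAssociated.measure_mul_prod_le` for an event with decreasing sections,
obtained by passing to its complement. -/
lemma PositivelyAssociated.measure_prod_le_mul {E F : Type*} [Preorder E] [MeasurableSpace E]
    [MeasurableSpace F] {μ : Measure E} {ν : Measure F} [IsProbabilityMeasure μ]
    [IsProbabilityMeasure ν] (hμ : PositivelyAssociated μ) {A : Set E} {C : Set (E × F)}
    (hA : IsUpperSet A) (hC : ∀ w, IsLowerSet {x | (x, w) ∈ C}) (mA : MeasurableSet A)
    (mC : MeasurableSet C) :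
    μ.prod ν (Prod.fst ⁻¹' A ∩ C) ≤ μ A * μ.prod ν C := by
  have h := hμ.measure_mul_prod_le (ν := ν) hA (C := Cᶜ) (fun w ↦ (hC w).compl) mA mC.compl
  have hfst : μ.prod ν (Prod.fst ⁻¹' A) = μ A :=
    measurePreserving_fst.measure_preimage mA.nullMeasurableSet
  have hsplit := measure_inter_add_sdiff (μ := μ.prod ν) (Prod.fst ⁻¹' A) mC
  have hcompl := measure_add_measure_compl (μ := μ.prod ν) mC
  rw [measure_univ] at hcompl
  rw [Set.sdiff_eq, hfst] at hsplit
  have hfin : μ A * μ.prod ν Cᶜ ≠ ∞ := ENNReal.mul_ne_top (measure_ne_top _ _) (measure_ne_top _ _)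
  refine (ENNReal.add_le_add_iff_right hfin).1 ?_
  calc μ.prod ν (Prod.fst ⁻¹' A ∩ C) + μ A * μ.prod ν Cᶜ
      ≤ μ.prod ν (Prod.fst ⁻¹' A ∩ C) + μ.prod ν (Prod.fst ⁻¹' A ∩ Cᶜ) := by gcongr
    _ = μ A * μ.prod ν C + μ A * μ.prod ν Cᶜ := by rw [hsplit, ← mul_add, hcompl, mul_one]

/-! ### Partial sums -/

lemma Fin.partialSum_mono {n : ℕ} (k : Fin (n + 1)) :
    Monotone fun x : Fin n → ℝ ↦ Fin.partialSum x k := by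
  intro x y h
  induction k using Fin.induction with
  | zero => simp
  | succ k ih =>
    simp only [Fin.partialSum_succ] at ih ⊢
    exact add_le_add ih (h k)

lemma Fin.measurable_partialSum {n : ℕ} (k : Fin (n + 1)) :
    Measurable fun x : Fin n → ℝ ↦ Fin.partialSum x k := by
  induction k using Fin.induction with
  | zero => simp
  | succ k ih =>
    simp only [Fin.partialSum_succ]
    exact ih.add (measurable_pi_apply k)

lemma Fin.partialSum_sub {n : ℕ} (b : Fin (n + 1) → ℝ) (k : Fin (n + 1)) :
    Fin.partialSum (fun i : Fin n ↦ b i.succ - b i.castSucc) k = b k - b 0 := by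
  induction k using Fin.induction with
  | zero => simp
  | succ k ih => rw [Fin.partialSum_succ, ih]; ring

/-! ### The inequalities on a finite set of times -/

section

variable {Ω : Type*} {mΩ : MeasurableSpace Ω} {P : Measure Ω} {B₁ B₂ : ℝ≥0 → Ω → ℝ} {ρ : ℝ}

/-- The part of `B₂` that is not explained by `B₁` is independent of `B₁`. -/
lemma IsCorrelatedBrownianPair.indepFun (hB : IsCorrelatedBrownianPair B₁ B₂ ρ P) :
    IndepFun (fun ω s ↦ B₁ s ω) (fun ω s ↦ B₂ s ω - ρ * B₁ s ω) P := by
  have := hB.gaussian.isProbabilityMeasure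
  have m₁ := hB.brownian_fst.aemeasurable
  have m₂ := hB.brownian_snd.aemeasurable
  apply IsGaussianProcess.indepFun_of_covariance_eq_zero
  · apply hB.gaussian.of_isGaussianProcess
    rintro (s | s)
    · exact ⟨{s},
        { toFun x := (x ⟨s, by simp⟩).1
          map_add' x y := by simp
          map_smul' c x := by simp }, by simp⟩
    · exact ⟨{s},
        { toFun x := (x ⟨s, by simp⟩).2 - ρ * (x ⟨s, by simp⟩).1
          map_add' x y := by simp; ring
          map_smul' c x := by simp; ring }, by simp⟩
  · exact m₁
  · exact fun s ↦ (m₂ s).sub ((m₁ s).const_mul ρ)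
  · intro s t
    have l₁ s : MemLp (B₁ s) 2 P :=
      (hB.brownian_fst.isGaussianProcess.hasGaussianLaw_eval s).memLp_two
    have l₂ s : MemLp (B₂ s) 2 P :=
      (hB.brownian_snd.isGaussianProcess.hasGaussianLaw_eval s).memLp_two
    rw [covariance_fun_sub_right (l₁ s) (l₂ t) ((l₁ t).const_mul ρ), covariance_const_mul_right,
      hB.covariance_cross, hB.brownian_fst.covariance_eval]
    simp

/-- On an increasing grid of times, the two exceedance events are the preimages, under the
independent pair (increments of `B₁`, values of `B₂ - ρ B₁`), of an event that is increasing in the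
increments and of an event whose sections at fixed `B₂ - ρ B₁` are monotone in the increments. -/
lemma IsCorrelatedBrownianPair.measure_exists_gt_grid (hB : IsCorrelatedBrownianPair B₁ B₂ ρ P)
    {n : ℕ} {t : Fin (n + 1) → ℝ≥0} (ht : Monotone t) (ht0 : t 0 = 0) (x₁ x₂ : ℝ) :
    (0 ≤ ρ → P {ω | ∃ k, x₁ < B₁ (t k) ω} * P {ω | ∃ k, x₂ < B₂ (t k) ω}
      ≤ P {ω | (∃ k, x₁ < B₁ (t k) ω) ∧ ∃ k, x₂ < B₂ (t k) ω}) ∧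
    (ρ ≤ 0 → P {ω | (∃ k, x₁ < B₁ (t k) ω) ∧ ∃ k, x₂ < B₂ (t k) ω}
      ≤ P {ω | ∃ k, x₁ < B₁ (t k) ω} * P {ω | ∃ k, x₂ < B₂ (t k) ω}) := by
  have := hB.gaussian.isProbabilityMeasure
  have m₁ := hB.brownian_fst.aemeasurable
  have m₂ := hB.brownian_snd.aemeasurable
  let X : Ω → Fin n → ℝ := fun ω i ↦ B₁ (t i.succ) ω - B₁ (t i.castSucc) ω
  let W : Ω → Fin (n + 1) → ℝ := fun ω k ↦ B₂ (t k) ω - ρ * B₁ (t k) ω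
  have mX : AEMeasurable X P := aemeasurable_pi_lambda _ fun i ↦ (m₁ _).sub (m₁ _)
  have mW : AEMeasurable W P :=
    aemeasurable_pi_lambda _ fun k ↦ (m₂ _).sub ((m₁ _).const_mul ρ)
  have mφ : Measurable fun (b : ℝ≥0 → ℝ) (i : Fin n) ↦ b (t i.succ) - b (t i.castSucc) := by
    fun_prop
  have mψ : Measurable fun (w : ℝ≥0 → ℝ) (k : Fin (n + 1)) ↦ w (t k) := by fun_prop
  have hXW : IndepFun X W P := hB.indepFun.comp mφ mψ
  have hlaw : P.map (fun ω ↦ (X ω, W ω)) = (P.map X).prod (P.map W) :=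
    (indepFun_iff_map_prod_eq_prod_map_map mX mW).1 hXW
  have : IsProbabilityMeasure (P.map X) := Measure.isProbabilityMeasure_map mX
  have : IsProbabilityMeasure (P.map W) := Measure.isProbabilityMeasure_map mW
  have hassoc : PositivelyAssociated (P.map X) := by
    have hind := hB.brownian_fst.hasIndepIncrements n t ht
    have hpi := (iIndepFun_iff_map_fun_eq_pi_map fun i ↦ (m₁ _).sub (m₁ _)).1 hind
    have (i : Fin n) : IsProbabilityMeasure
        (P.map fun ω ↦ B₁ (t i.succ) ω - B₁ (t i.castSucc) ω) :=
      Measure.isProbabilityMeasure_map ((m₁ _).sub (m₁ _))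
    exact hpi ▸ positivelyAssociated_pi _
  let A : Set (Fin n → ℝ) := {x | ∃ k, x₁ < Fin.partialSum x k}
  let C : Set ((Fin n → ℝ) × (Fin (n + 1) → ℝ)) :=
    {p | ∃ k, x₂ < ρ * Fin.partialSum p.1 k + p.2 k}
  have hA : IsUpperSet A := fun x y h ⟨k, hk⟩ ↦ ⟨k, hk.trans_le (Fin.partialSum_mono k h)⟩
  have mA : MeasurableSet A := by
    simp only [A, Set.ofPred_exists]
    exact .iUnion fun k ↦ measurableSet_lt measurable_const (Fin.measurable_partialSum k)
  have mC : MeasurableSet C := by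
    simp only [C, Set.ofPred_exists]
    exact .iUnion fun k ↦ measurableSet_lt measurable_const
      ((((Fin.measurable_partialSum k).comp measurable_fst).const_mul ρ).add
        ((measurable_pi_apply k).comp measurable_snd))
  have hsum : ∀ᵐ ω ∂P, ∀ k, Fin.partialSum (X ω) k = B₁ (t k) ω := by
    filter_upwards [hB.brownian_fst.eval_zero_ae_eq_zero] with ω hω k
    rw [Fin.partialSum_sub (fun k ↦ B₁ (t k) ω) k, ht0, hω, sub_zero]
  have e₁ : P {ω | ∃ k, x₁ < B₁ (t k) ω} = P.map X A := by
    rw [Measure.map_apply_of_aemeasurable mX mA]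
    refine measure_congr (Filter.eventuallyEq_set.2 (hsum.mono fun ω hω ↦ ?_))
    simp [A, hω]
  have e₂ : P {ω | ∃ k, x₂ < B₂ (t k) ω} = (P.map X).prod (P.map W) C := by
    rw [← hlaw, Measure.map_apply_of_aemeasurable (mX.prodMk mW) mC]
    refine measure_congr (Filter.eventuallyEq_set.2 (hsum.mono fun ω hω ↦ ?_))
    simp [C, W, hω]
  have e₃ : P {ω | (∃ k, x₁ < B₁ (t k) ω) ∧ ∃ k, x₂ < B₂ (t k) ω}
      = (P.map X).prod (P.map W) (Prod.fst ⁻¹' A ∩ C) := by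
    rw [← hlaw, Measure.map_apply_of_aemeasurable (mX.prodMk mW) ((measurable_fst mA).inter mC)]
    refine measure_congr (Filter.eventuallyEq_set.2 (hsum.mono fun ω hω ↦ ?_))
    simp [A, C, W, hω]
  rw [e₁, e₂, e₃]
  refine ⟨fun hρ ↦ hassoc.measure_mul_prod_le hA (fun w ↦ ?_) mA mC,
    fun hρ ↦ hassoc.measure_prod_le_mul hA (fun w ↦ ?_) mA mC⟩
  · rintro x y h ⟨k, hk⟩
    have := mul_le_mul_of_nonneg_left (Fin.partialSum_mono k h) hρ
    exact ⟨k, hk.trans_le (by simpa using this)⟩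
  · rintro x y h ⟨k, hk⟩
    have := mul_le_mul_of_nonpos_left (Fin.partialSum_mono k h) hρ
    exact ⟨k, hk.trans_le (by simpa using this)⟩

lemma IsCorrelatedBrownianPair.measure_exists_gt_finset (hB : IsCorrelatedBrownianPair B₁ B₂ ρ P)
    (I : Finset ℝ≥0) (hI : 0 ∈ I) (x₁ x₂ : ℝ) :
    (0 ≤ ρ → P {ω | ∃ s ∈ I, x₁ < B₁ s ω} * P {ω | ∃ s ∈ I, x₂ < B₂ s ω}
      ≤ P {ω | (∃ s ∈ I, x₁ < B₁ s ω) ∧ ∃ s ∈ I, x₂ < B₂ s ω}) ∧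
    (ρ ≤ 0 → P {ω | (∃ s ∈ I, x₁ < B₁ s ω) ∧ ∃ s ∈ I, x₂ < B₂ s ω}
      ≤ P {ω | ∃ s ∈ I, x₁ < B₁ s ω} * P {ω | ∃ s ∈ I, x₂ < B₂ s ω}) := by
  obtain ⟨n, hn⟩ : ∃ n, I.card = n + 1 :=
    Nat.exists_eq_succ_of_ne_zero (Finset.card_ne_zero_of_mem hI)
  have hrange : Set.range (I.orderEmbOfFin hn) = I := I.range_orderEmbOfFin hn
  have hex : ∀ p : ℝ≥0 → Prop, (∃ k, p (I.orderEmbOfFin hn k)) ↔ ∃ s ∈ I, p s := by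
    intro p
    rw [← Set.exists_range_iff, hrange]
    simp
  have h0 : I.orderEmbOfFin hn 0 = 0 := by
    obtain ⟨k, hk⟩ : (0 : ℝ≥0) ∈ Set.range (I.orderEmbOfFin hn) := hrange ▸ hI
    exact le_antisymm (hk ▸ (I.orderEmbOfFin hn).monotone (Fin.zero_le k)) zero_le
  have := hB.measure_exists_gt_grid (I.orderEmbOfFin hn).monotone h0 x₁ x₂
  simp_rw [fun ω ↦ hex fun s ↦ x₁ < B₁ s ω, fun ω ↦ hex fun s ↦ x₂ < B₂ s ω] at this
  exact this

/-! ### Passage to continuous time -/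

/-- The first `n` terms of a dense sequence of times, truncated at `t`, together with `0`. -/
noncomputable def denseTimes (t : ℝ≥0) (n : ℕ) : Finset ℝ≥0 :=
  insert 0 ((Finset.range n).image fun i ↦ min t (TopologicalSpace.denseSeq ℝ≥0 i))

lemma denseTimes_mono (t : ℝ≥0) : Monotone (denseTimes t) := fun _ _ h ↦
  Finset.insert_subset_insert _ (Finset.image_subset_image (Finset.range_mono h))

lemma runningSup_gt_iff {X : ℝ≥0 → Ω → ℝ} {t : ℝ≥0} {ω : Ω} (hX : Continuous (X · ω)) (x : ℝ) :
    x < runningSup X t ω ↔ ∃ n, ∃ s ∈ denseTimes t n, x < X s ω := by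
  have hc : Continuous fun s : Set.Icc (0 : ℝ≥0) t ↦ X s ω := hX.comp continuous_subtype_val
  have hbdd : BddAbove (Set.range fun s : Set.Icc (0 : ℝ≥0) t ↦ X s ω) :=
    (isCompact_range hc).bddAbove
  have : Nonempty (Set.Icc (0 : ℝ≥0) t) := ⟨⟨0, by simp⟩⟩
  rw [runningSup, lt_ciSup_iff hbdd]
  constructor
  · rintro ⟨s, hs⟩
    have hmin : Continuous fun u ↦ X (min t u) ω := hX.comp (continuous_const.min continuous_id)
    obtain ⟨i, hi⟩ := (TopologicalSpace.denseRange_denseSeq ℝ≥0).exists_mem_open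
      (isOpen_lt continuous_const hmin) ⟨s, by simpa [min_eq_right s.2.2] using hs⟩
    exact ⟨i + 1, _, Finset.mem_insert_of_mem
      (Finset.mem_image_of_mem _ (Finset.self_mem_range_succ i)), hi⟩
  · rintro ⟨n, s, hs, h⟩
    rcases Finset.mem_insert.1 hs with rfl | hs
    · exact ⟨⟨0, by simp⟩, h⟩
    · obtain ⟨i, -, rfl⟩ := Finset.mem_image.1 hs
      exact ⟨⟨_, zero_le, min_le_left _ _⟩, h⟩

/-- Both sides are limits along `denseTimes`. Continuity of measure along increasing unions does not
require measurability, so almost everywhere measurability of the processes is enough. -/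
lemma IsCorrelatedBrownianPair.measure_runningSup (hB : IsCorrelatedBrownianPair B₁ B₂ ρ P)
    (t : ℝ≥0) (x₁ x₂ : ℝ) :
    (0 ≤ ρ → P {ω | x₁ < runningSup B₁ t ω} * P {ω | x₂ < runningSup B₂ t ω}
      ≤ P {ω | x₁ < runningSup B₁ t ω ∧ x₂ < runningSup B₂ t ω}) ∧
    (ρ ≤ 0 → P {ω | x₁ < runningSup B₁ t ω ∧ x₂ < runningSup B₂ t ω}
      ≤ P {ω | x₁ < runningSup B₁ t ω} * P {ω | x₂ < runningSup B₂ t ω}) := by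
  have := hB.gaussian.isProbabilityMeasure
  let S (X : ℝ≥0 → Ω → ℝ) (x : ℝ) (n : ℕ) : Set Ω := {ω | ∃ s ∈ denseTimes t n, x < X s ω}
  have hS (X : ℝ≥0 → Ω → ℝ) (x : ℝ) : Monotone (S X x) :=
    fun _ _ h ω ⟨s, hs, hx⟩ ↦ ⟨s, denseTimes_mono t h hs, hx⟩
  have single {X : ℝ≥0 → Ω → ℝ} (hX : IsBrownianReal X P) (x : ℝ) :
      P {ω | x < runningSup X t ω} = P (⋃ n, S X x n) := by
    refine measure_congr (Filter.eventuallyEq_set.2 (hX.cont.mono fun ω hω ↦ ?_))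
    simpa [S] using runningSup_gt_iff hω x
  have hinter : P {ω | x₁ < runningSup B₁ t ω ∧ x₂ < runningSup B₂ t ω}
      = P (⋃ n, S B₁ x₁ n ∩ S B₂ x₂ n) := by
    rw [Set.iUnion_inter_of_monotone (hS _ _) (hS _ _)]
    refine measure_congr (Filter.eventuallyEq_set.2 ?_)
    filter_upwards [hB.brownian_fst.cont, hB.brownian_snd.cont] with ω h₁ h₂
    refine and_congr ?_ ?_
    · simpa [S] using runningSup_gt_iff h₁ x₁
    · simpa [S] using runningSup_gt_iff h₂ x₂
  have lim₁ := tendsto_measure_iUnion_atTop (μ := P) (hS B₁ x₁)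
  have lim₂ := tendsto_measure_iUnion_atTop (μ := P) (hS B₂ x₂)
  have lim₁₂ := tendsto_measure_iUnion_atTop (μ := P) (s := fun n ↦ S B₁ x₁ n ∩ S B₂ x₂ n)
    fun m n h ↦ Set.inter_subset_inter (hS _ _ h) (hS _ _ h)
  have limMul := ENNReal.Tendsto.mul lim₁ (.inr (measure_ne_top _ _)) lim₂
    (.inr (measure_ne_top _ _))
  have key n := hB.measure_exists_gt_finset (denseTimes t n) (Finset.mem_insert_self _ _) x₁ x₂
  rw [single hB.brownian_fst, single hB.brownian_snd, hinter]
  exact ⟨fun hρ ↦ le_of_tendsto_of_tendsto' limMul lim₁₂ fun n ↦ (key n).1 hρ,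
    fun hρ ↦ le_of_tendsto_of_tendsto' lim₁₂ limMul fun n ↦ (key n).2 hρ⟩

lemma IsCorrelatedBrownianPair.neg (hB : IsCorrelatedBrownianPair B₁ B₂ ρ P) :
    IsCorrelatedBrownianPair (-B₁) (-B₂) ρ P where
  brownian_fst := hB.brownian_fst.neg
  brownian_snd := hB.brownian_snd.neg
  gaussian := (hB.gaussian.smul fun _ ↦ -1).congr fun t ↦ .of_forall fun ω ↦ by simp
  covariance_cross s t := by
    have := hB.gaussian.isProbabilityMeasure
    rw [Pi.neg_apply, Pi.neg_apply, covariance_neg_left, covariance_neg_right, neg_neg, hB.covariance_cross]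

end

/-- This holds without any boundedness assumption, since in `ℝ` the infimum of a set is defined as
the negative of the supremum of its opposite. -/
lemma runningInf_eq_neg_runningSup_neg {Ω : Type*} (X : ℝ≥0 → Ω → ℝ) (t : ℝ≥0) (ω : Ω) :
    runningInf X t ω = -runningSup (-X) t ω := by
  simp only [runningInf, runningSup, Pi.neg_apply]
  rw [iInf, Real.sInf_def, iSup]
  congr 2
  ext y
  simp [neg_eq_iff_eq_neg]

theorem lemma4p5 {Ω : Type*} [MeasurableSpace Ω] (P : Measure Ω) [IsProbabilityMeasure P]
    (ρ : ℝ) (B₁ B₂ : ℝ≥0 → Ω → ℝ) (hB : IsCorrelatedBrownianPair B₁ B₂ ρ P)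
    (t : ℝ≥0) (x₁ x₂ : ℝ) (hx₁ : 0 < x₁) (hx₂ : 0 < x₂) :
    (ρ ∈ Set.Icc (0 : ℝ) 1 →
      P {ω | runningSup B₁ t ω > x₁} * P {ω | runningSup B₂ t ω > x₂}
          ≤ P {ω | runningSup B₁ t ω > x₁ ∧ runningSup B₂ t ω > x₂} ∧
      P {ω | runningInf B₁ t ω < -x₁} * P {ω | runningInf B₂ t ω < -x₂}
          ≤ P {ω | runningInf B₁ t ω < -x₁ ∧ runningInf B₂ t ω < -x₂}) ∧
    (ρ ∈ Set.Icc (-1 : ℝ) 0 →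
      P {ω | runningSup B₁ t ω > x₁ ∧ runningSup B₂ t ω > x₂}
          ≤ P {ω | runningSup B₁ t ω > x₁} * P {ω | runningSup B₂ t ω > x₂} ∧
      P {ω | runningInf B₁ t ω < -x₁ ∧ runningInf B₂ t ω < -x₂}
          ≤ P {ω | runningInf B₁ t ω < -x₁} * P {ω | runningInf B₂ t ω < -x₂}) := by
  have hsup := hB.measure_runningSup t x₁ x₂
  have hinf := hB.neg.measure_runningSup t x₁ x₂
  simp only [runningInf_eq_neg_runningSup_neg, neg_lt_neg_iff, gt_iff_lt]
  exact ⟨fun h ↦ ⟨hsup.1 h.1, hinf.1 h.1⟩, fun h ↦ ⟨hsup.2 h.2, hinf.2 h.2⟩⟩
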